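/- All systems are finite dimensional. For a linear map $\mathcal E$ on $2\times2$ complex matrices let $J(\mathcal E)=(\mathcal E\otimes\mathcal I)(|\Psi\rangle\langle\Psi|)$ with $|\Psi\rangle=\frac1{\sqrt2}\sum_i|ii\rangle$. A Gram matrix is a positive semidefinite matrix with unit diagonal. A circuit consists of memory systems $D',D,D''$, a memory state $\tau$ on $D'$, and quantum channels (completely positive trace-preserving maps) $\mathcal N_{en}$, taking the qubit and $D'$ to the qubit and $D$, and $\mathcal N_{de}$, taking the qubit and $D$ to the qubit and $D''$. It realizes the linear supermap $\Xi$ if $$\Xi[\mathcal E](\rho)=\mathrm{Tr}_{D''}\circ\mathcal N_{de}\circ(\mathcal E\otimes\mathcal I_D)\circ\mathcal N_{en}(\rho\otimes\tau)\qquad\text{for all }\mathcal E,\rho .$$ Its memory is passive if the state $\mathrm{Tr}_1[\mathcal N_{en}(\varrho\otimes\tau)]$ of $D$ is the same for all input states $\varrho$ of the qubit. A superchannel on qubit channels is a linear supermap realized by some circuit; it is a dephasing superchannel if $\langle i|\Xi[\mathcal E](|j\rangle\langle j|)|i\rangle=\langle i|\mathcal E(|j\rangle\langle j|)|i\rangle$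 for all qubit channels $\mathcal E$ and all $i,j\in\{0,1\}$. Proposition. Let $\Xi_{\mathbf C}$ be a dephasing superchannel on qubit channels with associated $4\times4$ Gram matrix $\mathbf C$, that is, $J(\Xi_{\mathbf C}[\mathcal E])=J(\mathcal E)\odot\mathbf C$ (entrywise product) for all $\mathcal E$. Write $\mathbf C$ in $2\times2$ blocks $C_{ij}$, $(C_{ij})_{kl}=\mathbf C_{ik,jl}$, where $i,j$ belong to the output and $k,l$ to the input. The following are equivalent: (i) $\Xi_{\mathbf C}$ is realized by some circuit with a passive memory; (ii) $\mathbf C=\sum_i q_i\,C_1^{(i)}\otimes C_2^{(i)}$, a finite sum, for some probabilities $q_i\ge 0$, $\sum_i q_i=1$, and some $2\times2$ Gram matrices $C_1^{(i)},C_2^{(i)}$; (iii) the two diagonal entries of the off-diagonal block $C_{01}$ are equal: $(C_{01})_{00}=(C_{01})_{11}$. -/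

import Mathlib

open Matrix
open scoped Kronecker ComplexOrder

noncomputable section

namespace Dephasing

/-- Linear maps taking operators on `ℂ^A` to operators on `ℂ^B`, in matrix form; the standard basis
is the distinguished (incoherent) basis. -/
abbrev OpMap (A B : Type) : Type := Matrix A A ℂ →ₗ[ℂ] Matrix B B ℂ

/-- The map `E ⊗ id_R` on operators on `ℂ^A ⊗ ℂ^R`, in blocks: `E ⊗ id_R` sends `∑ X_{rs} ⊗ |r⟩⟨s|`
to `∑ E(X_{rs}) ⊗ |r⟩⟨s|`. -/
def tensorId {A B : Type} (E : OpMap A B) (R : Type) (X : Matrix (A × R) (A × R) ℂ) :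
    Matrix (B × R) (B × R) ℂ :=
  Matrix.of fun p q => E (Matrix.of fun a a' => X (a, p.2) (a', q.2)) p.1 q.1

/-- Partial trace over the first tensor factor. -/
def traceFst {A D : Type} [Fintype A] (X : Matrix (A × D) (A × D) ℂ) : Matrix D D ℂ :=
  Matrix.of fun γ η => ∑ a, X (a, γ) (a, η)

/-- Partial trace over the second tensor factor. -/
def traceSnd {A D : Type} [Fintype D] (X : Matrix (A × D) (A × D) ℂ) : Matrix A A ℂ :=
  Matrix.of fun a b => ∑ θ, X (a, θ) (b, θ)

/-- Quantum states (density matrices). -/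
def IsState {A : Type} [Fintype A] (ρ : Matrix A A ℂ) : Prop :=
  ρ.PosSemidef ∧ ρ.trace = 1

/-- Complete positivity: `E ⊗ id_k` preserves positive semidefiniteness for every `k`. -/
def IsCompletelyPositive {A B : Type} (E : OpMap A B) : Prop :=
  ∀ (k : ℕ) (X : Matrix (A × Fin k) (A × Fin k) ℂ),
    X.PosSemidef → (tensorId E (Fin k) X).PosSemidef

/-- Quantum channels: completely positive trace-preserving linear maps. -/
def IsChannel {A B : Type} [Fintype A] [Fintype B] (E : OpMap A B) : Prop :=
  IsCompletelyPositive E ∧ ∀ X, (E X).trace = X.trace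

/-- The maximally entangled vector `|Ψ⟩ = d^{-1/2} ∑ |ii⟩`. -/
def maxEntangled (A : Type) [Fintype A] [DecidableEq A] : A × A → ℂ :=
  fun p => if p.1 = p.2 then ((1 / √(Fintype.card A : ℝ) : ℝ) : ℂ) else 0

/-- The Jamiołkowski operator `J(E) = (E ⊗ id)(|Ψ⟩⟨Ψ|)`: the first factor is the output. -/
def jam {A B : Type} [Fintype A] [DecidableEq A] (E : OpMap A B) : Matrix (B × A) (B × A) ℂ :=
  tensorId E A (Matrix.vecMulVec (maxEntangled A) (star (maxEntangled A)))

/-- Linear supermaps on maps from system `S` to system `S`. -/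
abbrev Supermap (S : Type) : Type := OpMap S S →ₗ[ℂ] OpMap S S

/-- A circuit around one slot for a channel on `S`: an initial memory state `τ`, an encoding channel
and a decoding channel, with finite-dimensional memories `D'`, `D`, `D''`. -/
structure Circuit (S : Type) [Fintype S] where
  /-- dimension of the initial memory `D'` -/
  dInit : ℕ
  /-- dimension of the memory `D` kept while the inserted channel acts -/
  dMem : ℕ
  /-- dimension of the final memory `D''` -/
  dFin : ℕ
  /-- initial memory state -/
  τ : Matrix (Fin dInit) (Fin dInit) ℂ
  isState : IsState τ
  /-- encoding map -/
  enc : OpMap (S × Fin dInit) (S × Fin dMem)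
  enc_isChannel : IsChannel enc
  /-- decoding map -/
  dec : OpMap (S × Fin dMem) (S × Fin dFin)
  dec_isChannel : IsChannel dec

namespace Circuit

variable {S : Type} [Fintype S]

/-- The output `Tr_{D''} ∘ N_de ∘ (E ⊗ id_D) ∘ N_en (ρ ⊗ τ)` of the circuit with `E` inserted. -/
def output (N : Circuit S) (E : OpMap S S) (ρ : Matrix S S ℂ) : Matrix S S ℂ :=
  traceSnd (N.dec (tensorId E (Fin N.dMem) (N.enc (ρ ⊗ₖ N.τ))))

/-- The circuit implements the supermap `Ξ`. -/
def Realizes (N : Circuit S) (Ξ : Supermap S) : Prop :=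
  ∀ E ρ, Ξ E ρ = N.output E ρ

/-- The state `Tr_1[N_en(ρ ⊗ τ)]` of the memory after the encoding of the input `ρ`. -/
def memory (N : Circuit S) (ρ : Matrix S S ℂ) : Matrix (Fin N.dMem) (Fin N.dMem) ℂ :=
  traceFst (N.enc (ρ ⊗ₖ N.τ))

/-- The memory is passive: its state does not depend on the input state of the system. -/
def IsPassive (N : Circuit S) : Prop :=
  ∀ ρ ρ' : Matrix S S ℂ, IsState ρ → IsState ρ' → N.memory ρ = N.memory ρ'

end Circuit

/-- Superchannels: the supermaps implemented by some circuit. -/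
def IsSuperchannel {S : Type} [Fintype S] (Ξ : Supermap S) : Prop :=
  ∃ N : Circuit S, N.Realizes Ξ

/-- Dephasing superchannels: superchannels that keep all transition probabilities in the
distinguished basis, `⟨i|Ξ[E](|j⟩⟨j|)|i⟩ = ⟨i|E(|j⟩⟨j|)|i⟩` for every channel `E`. -/
def IsDephasingSuperchannel {S : Type} [Fintype S] [DecidableEq S] (Ξ : Supermap S) : Prop :=
  IsSuperchannel Ξ ∧ ∀ E : OpMap S S, IsChannel E → ∀ i j : S,
    Ξ E (Matrix.single j j 1) i i = E (Matrix.single j j 1) i i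

/-- `C` is the matrix associated with the supermap `Ξ`: `J(Ξ[E]) = J(E) ⊙ C` for all `E`. The row
index `(i, k)` of `C` is the `k`-th row of the `i`-th row of blocks. -/
def IsAssociatedMatrix {S : Type} [Fintype S] [DecidableEq S] (Ξ : Supermap S)
    (C : Matrix (S × S) (S × S) ℂ) : Prop :=
  ∀ E : OpMap S S, jam (Ξ E) = Matrix.hadamard (jam E) C

/-- Gram matrices: positive semidefinite matrices with unit diagonal. -/
def IsGram {A : Type} (C : Matrix A A ℂ) : Prop :=
  C.PosSemidef ∧ ∀ a, C a a = 1

/-- The Gram matrix is a convex combination `∑ q_i C₁⁽ⁱ⁾ ⊗ C₂⁽ⁱ⁾` of tensor products of Gram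
matrices. -/
def IsClassicalMixture {S : Type} (C : Matrix (S × S) (S × S) ℂ) : Prop :=
  ∃ (n : ℕ) (q : Fin n → ℝ) (C₁ C₂ : Fin n → Matrix S S ℂ),
    (∀ i, 0 ≤ q i) ∧ ∑ i, q i = 1 ∧ (∀ i, IsGram (C₁ i)) ∧ (∀ i, IsGram (C₂ i)) ∧
      C = ∑ i, (q i : ℂ) • (C₁ i ⊗ₖ C₂ i)

/-- The block `C_{ij}` of `C`. -/
def block {S : Type} (C : Matrix (S × S) (S × S) ℂ) (i j : S) : Matrix S S ℂ :=
  Matrix.of fun k l => C (i, k) (j, l)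

end Dephasing

end

/-!
The matrix `C` multiplies the matrix elements `⟨i|E(|k⟩⟨l|)|j⟩`. Inserting suitable maps `E`, not
necessarily channels, into a realizing circuit yields all that is needed about `C`: complete
positivity gives `0 ≤ C` (`IsAssociatedMatrix.posSemidef`), and trace preservation gives unit
diagonal and `C₀₀ = C₁₁` (`IsAssociatedMatrix.trace_relation`).

If the memory is passive, insert `E(X) = tr X · (all-ones)`. This discards the system, so the output
depends on the input only through the memory, while its off-diagonal entry for the input `|k⟩⟨k|` is
`(C₀₁)ₖₖ`. Hence `(C₀₁)₀₀ = (C₀₁)₁₁` (`block_diag_eq_of_passive`).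

Conversely, let these entries agree. Writing `C` as the Gram matrix of vectors `vᵢₖ`, the equality
`C₀₀ = C₁₁` provides a unitary with `v₀ₖ ↦ v₁ₖ`. Diagonalizing it writes `C` as `∑ Gᵢ ⊗ Pᵢ` with
Gram matrices `Gᵢ` and `Pᵢ ≥ 0` (`exists_block_decomposition`). Now every block of `C` has constant
diagonal, so averaging the diagonal entries of each `Pᵢ` does not change the sum and turns `Pᵢ` into
a multiple of a Gram matrix (`isClassicalMixture_of_blocks`). A mixture of products is realized with
a classical random label as memory, which selects Hadamard multiplications before and after the slot
(`exists_passive_circuit`).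
-/

open Matrix
open scoped Kronecker ComplexOrder

namespace Dephasing

/-! ### Hadamard multiplication as a channel, and traces -/

section Maps
variable {A B D R : Type}

/-- Schur's product theorem: `E ⊗ id_k` is again entrywise multiplication, by the positive
semidefinite matrix that repeats `G` along the second factor. -/
theorem isCompletelyPositive_of_hadamard [Finite A] {G : Matrix A A ℂ} (hG : G.PosSemidef)
    (E : OpMap A A) (hE : ∀ X, E X = hadamard G X) : IsCompletelyPositive E := by
  intro k X hX
  have : tensorId E (Fin k) X = hadamard (G.submatrix Prod.fst Prod.fst) X := by
    ext p q
    simp [tensorId, hE, hadamard]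
  rw [this]
  exact (hG.submatrix _).hadamard hX

/-- Entrywise multiplication by a fixed matrix, as a linear map. -/
def hadamardMap (G : Matrix A A ℂ) : OpMap A A where
  toFun X := hadamard G X
  map_add' := by intros; ext; simp [hadamard, mul_add]
  map_smul' := by intros; ext; simp [hadamard, mul_left_comm]

theorem isChannel_hadamardMap [Fintype A] {G : Matrix A A ℂ} (hG : IsGram G) :
    IsChannel (hadamardMap G) := by
  refine ⟨isCompletelyPositive_of_hadamard hG.1 _ fun X => rfl, fun X => ?_⟩
  simp [hadamardMap, hadamard, Matrix.trace, hG.2]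

theorem trace_traceSnd [Fintype A] [Fintype D] (X : Matrix (A × D) (A × D) ℂ) :
    (traceSnd X).trace = X.trace := by
  simp [traceSnd, Matrix.trace, Fintype.sum_prod_type]

theorem trace_tensorId [Fintype A] [Fintype B] [Fintype R] {E : OpMap A B}
    (hE : ∀ X, (E X).trace = X.trace) (X : Matrix (A × R) (A × R) ℂ) :
    (tensorId E R X).trace = X.trace := by
  simp only [tensorId, Matrix.trace, Fintype.sum_prod_type_right, Matrix.diag, Matrix.of_apply]
  refine Finset.sum_congr rfl fun r _ => ?_
  have := hE (Matrix.of fun a a' => X (a, r) (a', r))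
  simpa [Matrix.trace] using this

theorem posSemidef_sum_submatrix {ι : Type} [Fintype ι] [Finite A]
    {X : Matrix A A ℂ} (hX : X.PosSemidef) (f : ι → B → A) :
    (∑ i, X.submatrix (f i) (f i)).PosSemidef :=
  posSemidef_sum _ fun _ _ => hX.submatrix _

end Maps

theorem Circuit.trace_output {S : Type} [Fintype S] (N : Circuit S) {E : OpMap S S}
    (hE : ∀ X, (E X).trace = X.trace) (ρ : Matrix S S ℂ) : (N.output E ρ).trace = ρ.trace := by
  rw [Circuit.output, trace_traceSnd, N.dec_isChannel.2, trace_tensorId hE, N.enc_isChannel.2,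
    Matrix.trace_kronecker, N.isState.2, mul_one]

/-! ### The matrix associated with a superchannel -/

theorem jam_apply {S : Type} [Fintype S] [DecidableEq S] (E : OpMap S S) (i k j l : S) :
    jam E (i, k) (j, l) = (Fintype.card S : ℂ)⁻¹ * E (Matrix.single k l 1) i j := by
  have : (Matrix.of fun a a' => Matrix.vecMulVec (maxEntangled S) (star (maxEntangled S)) (a, k)
      (a', l)) = (Fintype.card S : ℂ)⁻¹ • Matrix.single k l (1 : ℂ) := by
    ext a b
    have h : ((√(Fintype.card S : ℝ) : ℝ) : ℂ)⁻¹ * ((√(Fintype.card S : ℝ) : ℝ) : ℂ)⁻¹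
        = (Fintype.card S : ℂ)⁻¹ := by
      rw [← mul_inv, ← Complex.ofReal_mul, Real.mul_self_sqrt (by positivity)]
      simp
    by_cases ha : a = k <;> by_cases hb : b = l
    · subst ha hb
      simpa [maxEntangled, Matrix.vecMulVec] using h
    all_goals simp [maxEntangled, Matrix.vecMulVec, ha, hb, eq_comm (a := k),
      eq_comm (a := l)]
  simp only [jam, tensorId, Matrix.of_apply]
  rw [this, map_smul, Matrix.smul_apply, smul_eq_mul]

/-- In matrix elements, the associated matrix multiplies `⟨i|E(|k⟩⟨l|)|j⟩` by `C (i, k) (j, l)`. -/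
theorem IsAssociatedMatrix.apply_single {S : Type} [Fintype S] [DecidableEq S] {Ξ : Supermap S}
    {C : Matrix (S × S) (S × S) ℂ} (hC : IsAssociatedMatrix Ξ C) (E : OpMap S S) (i j k l : S) :
    Ξ E (Matrix.single k l 1) i j = E (Matrix.single k l 1) i j * C (i, k) (j, l) := by
  have h := congrFun (congrFun (hC E) (i, k)) (j, l)
  have : Nonempty S := ⟨i⟩
  simp only [hadamard_apply, jam_apply, mul_assoc] at h
  exact mul_left_cancel₀ (by simp) h

/-- The Choi matrix of the map produced by a circuit from `E : X ↦ (∑ X_{ab}) · (all-ones)`, which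
is completely positive but not trace preserving, is positive semidefinite. -/
theorem Circuit.choi_posSemidef (N : Circuit (Fin 2)) (E : OpMap (Fin 2) (Fin 2))
    (hE : ∀ X i j, E X i j = ∑ a, ∑ b, X a b) :
    (Matrix.of fun p q : Fin 2 × Fin 2 =>
      N.output E (Matrix.single p.2 q.2 1) p.1 q.1).PosSemidef := by
  -- `X₀` is `∑ |k⟩⟨l| ⊗ τ ⊗ |k⟩⟨l|`, the reference qubit being the last factor; `X₂` is its image
  -- under the encoder followed by `E`, and the Choi matrix is the partial trace of the decoded `X₂`
  let ω : Fin 2 × Fin 2 → ℂ := fun p => if p.1 = p.2 then 1 else 0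
  let X₀ : Matrix ((Fin 2 × Fin N.dInit) × Fin 2) ((Fin 2 × Fin N.dInit) × Fin 2) ℂ :=
    (vecMulVec ω (star ω) ⊗ₖ N.τ).submatrix (fun p => ((p.1.1, p.2), p.1.2))
      (fun p => ((p.1.1, p.2), p.1.2))
  have h₀ : X₀.PosSemidef :=
    ((posSemidef_vecMulVec_self_star ω).kronecker N.isState.1).submatrix _
  have h₁ := N.enc_isChannel.1 2 X₀ h₀
  let X₂ : Matrix ((Fin 2 × Fin N.dMem) × Fin 2) ((Fin 2 × Fin N.dMem) × Fin 2) ℂ :=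
    Matrix.of fun p q => ∑ a, ∑ b,
      tensorId N.enc (Fin 2) X₀ ((a, p.1.2), p.2) ((b, q.1.2), q.2)
  have h₂ : X₂.PosSemidef := by
    let B : Matrix ((Fin 2 × Fin N.dMem) × Fin 2) ((Fin 2 × Fin N.dMem) × Fin 2) ℂ :=
      Matrix.of fun p q => if p.1.2 = q.1.2 ∧ p.2 = q.2 then 1 else 0
    have : X₂ = B * tensorId N.enc (Fin 2) X₀ * Bᴴ := by
      ext p q
      simp [X₂, B, Matrix.mul_apply, Fintype.sum_prod_type, ite_and, apply_ite,
        Finset.sum_add_distrib]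
      ring
    rw [this]
    exact h₁.mul_mul_conjTranspose_same B
  have h₃ := N.dec_isChannel.1 2 X₂ h₂
  have h₄ := posSemidef_sum_submatrix h₃
    (fun (θ : Fin N.dFin) (p : Fin 2 × Fin 2) => ((p.1, θ), p.2))
  convert h₄ using 1
  ext p q
  simp only [Circuit.output, traceSnd, Matrix.of_apply, Matrix.sum_apply, Matrix.submatrix_apply]
  refine Finset.sum_congr rfl fun θ _ => ?_
  conv_rhs => rw [tensorId, Matrix.of_apply]
  dsimp only
  refine congrFun₂ (congrArg N.dec (Matrix.ext fun x y => ?_)) _ _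
  simp only [tensorId, Matrix.of_apply, hE, X₂]
  refine Finset.sum_congr rfl fun s _ => Finset.sum_congr rfl fun t _ => ?_
  refine congrFun₂ (congrArg N.enc (Matrix.ext fun a b => ?_)) _ _
  simp [X₀, ω, Matrix.vecMulVec, Matrix.single_apply, ite_and]
  aesop

/-- The matrix `C` is the Choi matrix of `Ξ[E]` for the map `E` with `⟨i|E(|k⟩⟨l|)|j⟩ = 1`
throughout. -/
theorem IsAssociatedMatrix.posSemidef {Ξ : Supermap (Fin 2)}
    {C : Matrix (Fin 2 × Fin 2) (Fin 2 × Fin 2) ℂ}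
    (hΞ : IsSuperchannel Ξ) (hC : IsAssociatedMatrix Ξ C) : C.PosSemidef := by
  obtain ⟨N, hN⟩ := hΞ
  let E : OpMap (Fin 2) (Fin 2) :=
    { toFun X := Matrix.of fun _ _ => ∑ a, ∑ b, X a b
      map_add' := by intros; ext; simp [Finset.sum_add_distrib]
      map_smul' := by intros; ext; simp [mul_add] }
  convert N.choi_posSemidef E fun _ _ _ => rfl using 1
  ext p q
  rw [Matrix.of_apply, ← hN, hC.apply_single]
  have : E (Matrix.single p.2 q.2 1) p.1 q.1 = 1 := by
    simp only [E, LinearMap.coe_mk, AddHom.coe_mk, Matrix.of_apply]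
    simp [Matrix.single_apply, ite_and]
  simp [this]

/-- Trace preservation of `Ξ[E]` on `|k⟩⟨l|`, for the trace-preserving map `E` whose value at
`|k⟩⟨l|` is diagonal with entries `z` and `δ_{kl} - z`. As `z` is arbitrary, this fixes the diagonal
of `C` and makes its two diagonal blocks equal. -/
theorem IsAssociatedMatrix.trace_relation {Ξ : Supermap (Fin 2)}
    {C : Matrix (Fin 2 × Fin 2) (Fin 2 × Fin 2) ℂ}
    (hΞ : IsSuperchannel Ξ) (hC : IsAssociatedMatrix Ξ C) (z : ℂ) (k l : Fin 2) :
    z * C (0, k) (0, l) + ((if k = l then 1 else 0) - z) * C (1, k) (1, l) =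
      if k = l then 1 else 0 := by
  obtain ⟨N, hN⟩ := hΞ
  let E : OpMap (Fin 2) (Fin 2) :=
    { toFun X := Matrix.diagonal ![z * X k l, X.trace - z * X k l]
      map_add' := by
        intros; ext i j; fin_cases i <;> fin_cases j <;> simp <;> ring
      map_smul' := by
        intros; ext i j; fin_cases i <;> fin_cases j <;> simp <;> ring }
  have h := N.trace_output (E := E) (fun X => by simp [E, Matrix.trace_fin_two])
    (Matrix.single k l 1)
  rw [← hN, Matrix.trace_fin_two, hC.apply_single, hC.apply_single] at h
  have e : (Matrix.single k l (1 : ℂ)).trace = if k = l then 1 else 0 := by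
    split_ifs with hkl
    · subst hkl; simp
    · simp [Matrix.trace_single_eq_of_ne _ _ _ hkl]
  simpa [E, e] using h

theorem IsAssociatedMatrix.apply_diag {Ξ : Supermap (Fin 2)}
    {C : Matrix (Fin 2 × Fin 2) (Fin 2 × Fin 2) ℂ}
    (hΞ : IsSuperchannel Ξ) (hC : IsAssociatedMatrix Ξ C) (p : Fin 2 × Fin 2) : C p p = 1 := by
  obtain ⟨i, k⟩ := p
  have h0 := IsAssociatedMatrix.trace_relation hΞ hC 0 k k
  have h1 := IsAssociatedMatrix.trace_relation hΞ hC 1 k k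
  fin_cases i
  · simpa using h1
  · simpa using h0

theorem IsAssociatedMatrix.block_zero_eq_block_one {Ξ : Supermap (Fin 2)}
    {C : Matrix (Fin 2 × Fin 2) (Fin 2 × Fin 2) ℂ}
    (hΞ : IsSuperchannel Ξ) (hC : IsAssociatedMatrix Ξ C) : block C 0 0 = block C 1 1 := by
  ext k l
  have h0 := IsAssociatedMatrix.trace_relation hΞ hC 0 k l
  have h1 := IsAssociatedMatrix.trace_relation hΞ hC 1 k l
  simp only [block, Matrix.of_apply]
  linear_combination h1 - h0

/-! ### Unitaries: extension and diagonalization -/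

/-- Linear maps with the same norms of values differ by a unitary. -/
theorem exists_linearIsometry_of_norm_eq {V E : Type*} [AddCommGroup V] [Module ℂ V]
    [NormedAddCommGroup E] [InnerProductSpace ℂ E] [FiniteDimensional ℂ E] (S T : V →ₗ[ℂ] E)
    (h : ∀ c, ‖T c‖ = ‖S c‖) : ∃ U : E →ₗᵢ[ℂ] E, ∀ c, U (S c) = T c := by
  obtain ⟨g, hg⟩ := S.rangeRestrict.exists_rightInverse_of_surjective S.range_rangeRestrict
  have hg' (x : LinearMap.range S) : S (g x) = x := congrArg Subtype.val (LinearMap.congr_fun hg x)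
  let L : LinearMap.range S →ₗᵢ[ℂ] E := ⟨T ∘ₗ g, fun x => by
    simp [h, hg']⟩
  refine ⟨L.extend, fun c => ?_⟩
  have h1 : L.extend (S c) = T (g (S.rangeRestrict c)) := L.extend_apply (S.rangeRestrict c)
  rw [h1, ← sub_eq_zero, ← norm_eq_zero, ← map_sub, h, map_sub, hg']
  simp

/-- Spectral theorem for unitaries on an `m`-dimensional space; `φ i x` is the `i`-th coordinate of
`x` in an orthonormal basis of eigenvectors. -/
theorem exists_diagonalization (m : ℕ) : ∀ (E : Type) [NormedAddCommGroup E]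
    [InnerProductSpace ℂ E] [FiniteDimensional ℂ E] (U : E →ₗᵢ[ℂ] E), Module.finrank ℂ E = m →
    ∃ (φ : Fin m → E → ℂ) (u : Fin m → ℂ), (∀ i, ‖u i‖ = 1) ∧
      (∀ x y, inner ℂ x y = ∑ i, star (φ i x) * φ i y) ∧
      ∀ x y, inner ℂ x (U y) = ∑ i, star (φ i x) * u i * φ i y := by
  induction m with
  | zero =>
    intro E _ _ _ U hE
    have := Module.finrank_zero_iff.1 hE
    refine ⟨Fin.elim0, Fin.elim0, fun i => i.elim0, fun x y => ?_, fun x y => ?_⟩ <;>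
      simp [Subsingleton.elim x 0]
  | succ m ih =>
    intro E _ _ _ U hE
    have : Nontrivial E := Module.nontrivial_of_finrank_pos (R := ℂ) (by omega)
    obtain ⟨c, hc⟩ := Module.End.exists_eigenvalue U.toLinearMap
    obtain ⟨v, hv⟩ := hc.exists_hasEigenvector
    have hUv : U v = c • v := hv.apply_eq_smul
    have hv0 : ‖v‖ ≠ 0 := norm_ne_zero_iff.2 hv.2
    obtain ⟨e, he, hUe⟩ : ∃ e : E, ‖e‖ = 1 ∧ U e = c • e := by
      refine ⟨(‖v‖⁻¹ : ℂ) • v, ?_, by rw [map_smul, hUv, smul_comm]⟩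
      rw [norm_smul]
      simp [hv0]
    have hc1 : ‖c‖ = 1 := by
      have := U.norm_map e
      rwa [hUe, norm_smul, he, mul_one] at this
    have hee : inner ℂ e e = (1 : ℂ) := by simp [inner_self_eq_norm_sq_to_K, he]
    have hcc : star c * c = 1 := by
      have := Complex.conj_mul' c
      simpa [hc1] using this
    let F := (ℂ ∙ e)ᗮ
    have hF (x : E) : x ∈ F ↔ inner ℂ e x = 0 := Submodule.mem_orthogonal_singleton_iff_inner_right
    -- the complement of an eigenvector is invariant because `U` preserves inner products
    have hUF (x : E) : inner ℂ e (U x) = c * inner ℂ e x := by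
      have h1 : inner ℂ (U e) (U x) = inner ℂ e x := U.inner_map_map e x
      rw [hUe, inner_smul_left] at h1
      rw [← h1, ← mul_assoc, mul_comm c]
      exact (by rw [show (starRingEnd ℂ) c * c = 1 from hcc, one_mul])
    let U' : F →ₗᵢ[ℂ] F := ⟨U.toLinearMap.restrict (p := F) (q := F) (fun x hx => by
      rw [hF] at hx ⊢
      simp [hUF, hx]), fun x => by
        change ‖U x‖ = _
        rw [U.norm_map]; rfl⟩
    have hfin : Module.finrank ℂ F = m := by
      have : Fact (Module.finrank ℂ E = m + 1) := ⟨hE⟩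
      exact Submodule.finrank_orthogonal_span_singleton (by rintro rfl; simp at he)
    obtain ⟨φ, u, hu, hφ, hφU⟩ := ih F U' hfin
    let π : E → F := fun x => ⟨x - inner ℂ e x • e, by
      rw [hF, inner_sub_right, inner_smul_right, hee]; simp⟩
    have hdec (x : E) : x = inner ℂ e x • e + (π x : E) := by simp [π]
    have hin (x : E) (y : F) (a : ℂ) : inner ℂ x (a • e + (y : E)) =
        star (inner ℂ e x) * a + inner ℂ (π x) y := by
      have h1 : inner ℂ e (y : E) = (0 : ℂ) := (hF y).1 y.2
      rw [Submodule.coe_inner]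
      simp only [π, inner_add_right, inner_sub_left, inner_smul_left, inner_smul_right, h1]
      simp [mul_comm]
    have hUd (y : E) : U y = (c * inner ℂ e y) • e + ((U' (π y) : F) : E) := by
      conv_lhs => rw [hdec y]
      rw [map_add, map_smul, hUe, smul_smul, mul_comm]
      rfl
    refine ⟨Fin.cons (fun x => inner ℂ e x) fun i x => φ i (π x), Fin.cons c u, ?_, ?_, ?_⟩
    · intro i
      refine Fin.cases hc1 (fun i => by simpa using hu i) i
    · intro x y
      conv_lhs => rw [hdec y]
      rw [hin, hφ, Fin.sum_univ_succ]
      simp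
    · intro x y
      rw [hUd, hin, hφU, Fin.sum_univ_succ]
      simp [mul_assoc]

/-! ### Decomposing the matrix -/

theorem isGram_of_norm_le_one {y : ℂ} (hy : ‖y‖ ≤ 1) : IsGram !![1, y; star y, 1] := by
  refine ⟨?_, fun a => by fin_cases a <;> simp⟩
  have h : !![1, y; star y, 1] = vecMulVec ![1, star y] (star ![1, star y]) +
      Matrix.diagonal ![0, ((1 - ‖y‖ ^ 2 : ℝ) : ℂ)] := by
    have := Complex.conj_mul' y
    ext i j
    fin_cases i <;> fin_cases j <;> simp [vecMulVec, this]
  rw [h]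
  refine (posSemidef_vecMulVec_self_star _).add (PosSemidef.diagonal ?_)
  intro i
  fin_cases i
  · simp
  · have : (0 : ℝ) ≤ 1 - ‖y‖ ^ 2 := by nlinarith [norm_nonneg y]
    simpa using Complex.zero_le_real.2 this

/-- A positive semidefinite matrix with equal diagonal blocks is `∑ Gᵢ ⊗ Pᵢ` with
`Gᵢ = [1, uᵢ; ūᵢ, 1]`, `|uᵢ| = 1`, and `Pᵢ` of rank at most one, `(Pᵢ)ₖₗ = x̄ᵢₖ xᵢₗ`. If `C` is the
Gram matrix of vectors `vᵢₖ`, some unitary sends every `v₀ₖ` to `v₁ₖ`, and its diagonalization gives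
the `uᵢ`, with `xᵢₖ` the coordinates of `v₀ₖ`. -/
theorem exists_block_decomposition {C : Matrix (Fin 2 × Fin 2) (Fin 2 × Fin 2) ℂ}
    (hC : C.PosSemidef) (hb : block C 0 0 = block C 1 1) :
    ∃ (n : ℕ) (x : Fin n → Fin 2 → ℂ) (u : Fin n → ℂ), (∀ i, ‖u i‖ = 1) ∧
      (∀ k l, C (0, k) (0, l) = ∑ i, star (x i k) * x i l) ∧
      ∀ k l, C (0, k) (1, l) = ∑ i, star (x i k) * u i * x i l := by
  obtain ⟨B, rfl⟩ : ∃ B : Matrix (Fin 2 × Fin 2) (Fin 2 × Fin 2) ℂ, C = Bᴴ * B := by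
    open scoped MatrixOrder in
    exact CStarAlgebra.nonneg_iff_eq_star_mul_self.1 (Matrix.nonneg_iff_posSemidef.2 hC)
  let v : Fin 2 × Fin 2 → EuclideanSpace ℂ (Fin 2 × Fin 2) := fun p => WithLp.toLp 2 fun r => B r p
  have hv (p q) : inner ℂ (v p) (v q) = (Bᴴ * B) p q := by
    simp [v, Matrix.mul_apply, PiLp.inner_apply, mul_comm]
  let T (i : Fin 2) : (Fin 2 → ℂ) →ₗ[ℂ] EuclideanSpace ℂ (Fin 2 × Fin 2) :=
    Fintype.linearCombination ℂ fun k => v (i, k)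
  have hT (i k : Fin 2) : T i (Pi.single k 1) = v (i, k) := by
    simp [T, Fintype.linearCombination_apply_single]
  have hn (i : Fin 2) (c : Fin 2 → ℂ) : inner ℂ (T i c) (T i c) =
      ∑ l, c l * ∑ k, star (c k) * block (Bᴴ * B) i i k l := by
    simp only [T, Fintype.linearCombination_apply, sum_inner, inner_sum, inner_smul_left,
      inner_smul_right, hv, block, Matrix.of_apply]
    rfl
  obtain ⟨U, hU⟩ := exists_linearIsometry_of_norm_eq (T 0) (T 1) fun c => by
    rw [@norm_eq_sqrt_re_inner ℂ, @norm_eq_sqrt_re_inner ℂ, hn, hn, hb]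
  obtain ⟨φ, u, hu, h1, h2⟩ := exists_diagonalization _ _ U rfl
  refine ⟨_, fun i k => φ i (v (0, k)), u, hu, fun k l => ?_, fun k l => ?_⟩
  · rw [← hv, h1]
  · rw [← hv, ← h2, ← hT 0 l, hU, hT]

/-- The blocks of `C` have constant diagonal (Toeplitz form), so the second factors of
`exists_block_decomposition` may be replaced by their Toeplitz parts, obtained by averaging the two
diagonal entries; these are multiples `q i` of Gram matrices with off-diagonal entry `y i`. -/
theorem isClassicalMixture_of_blocks {C : Matrix (Fin 2 × Fin 2) (Fin 2 × Fin 2) ℂ}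
    (hC : C.PosSemidef) (hd : ∀ p, C p p = 1) (hb : block C 0 0 = block C 1 1)
    (h : block C 0 1 0 0 = block C 0 1 1 1) : IsClassicalMixture C := by
  obtain ⟨n, x, u, hu, hA, hB⟩ := exists_block_decomposition hC hb
  let q (i : Fin n) : ℝ := (‖x i 0‖ ^ 2 + ‖x i 1‖ ^ 2) / 2
  -- for `q i = 0` the junk value `y i = 0` is harmless, as then `x i = 0`
  let y (i : Fin n) : ℂ := star (x i 0) * x i 1 / q i
  have hq (i) : 0 ≤ q i := by positivity
  have hxq (i) : ‖star (x i 0) * x i 1‖ ≤ q i := by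
    rw [norm_mul, norm_star]
    simp only [q]
    nlinarith [sq_nonneg (‖x i 0‖ - ‖x i 1‖)]
  have hy (i) : ‖y i‖ ≤ 1 := by
    simp only [y, norm_div, Complex.norm_real, Real.norm_of_nonneg (hq i)]
    exact div_le_one_of_le₀ (hxq i) (hq i)
  have hqy (i) : q i * y i = star (x i 0) * x i 1 := by
    by_cases h0 : q i = 0
    · have := hxq i
      rw [h0, norm_le_zero_iff] at this
      rw [h0, this]; simp
    · have : (q i : ℂ) ≠ 0 := by exact_mod_cast h0
      simp only [y]
      field_simp
  have hqy' (i) : q i * star (y i) = star (x i 1) * x i 0 := by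
    have := congrArg star (hqy i)
    simpa [mul_comm] using this
  have hqx (i) : (q i : ℂ) = (star (x i 0) * x i 0 + star (x i 1) * x i 1) / 2 := by
    have h0 := Complex.conj_mul' (x i 0)
    have h1 := Complex.conj_mul' (x i 1)
    simp only [q, Complex.star_def, h0, h1]
    push_cast
    ring
  have hq1 : ∑ i, (q i : ℂ) = 1 := by
    simp only [hqx, ← Finset.sum_div, Finset.sum_add_distrib, ← hA, hd]
    norm_num
  have hqu : ∑ i, (q i : ℂ) * u i = C (0, 0) (1, 0) := by
    have h' : C (0, 0) (1, 0) = C (0, 1) (1, 1) := h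
    have h2 : ∑ i, (q i : ℂ) * u i = (C (0, 0) (1, 0) + C (0, 1) (1, 1)) / 2 := by
      rw [hB, hB, ← Finset.sum_add_distrib, Finset.sum_div]
      exact Finset.sum_congr rfl fun i _ => by rw [hqx]; ring
    rw [h2, ← h']; ring
  have hA' : ∑ i, (q i : ℂ) * y i = C (0, 0) (0, 1) := by
    rw [hA]; exact Finset.sum_congr rfl fun i _ => hqy i
  have hB1 : ∑ i, (q i : ℂ) * (u i * y i) = C (0, 0) (1, 1) := by
    rw [hB]; exact Finset.sum_congr rfl fun i _ => by linear_combination u i * hqy i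
  have hB2 : ∑ i, (q i : ℂ) * (u i * star (y i)) = C (0, 1) (1, 0) := by
    rw [hB]; exact Finset.sum_congr rfl fun i _ => by linear_combination u i * hqy' i
  refine ⟨n, q, fun i => !![1, u i; star (u i), 1], fun i => !![1, y i; star (y i), 1], hq,
    by exact_mod_cast hq1, fun i => isGram_of_norm_le_one (hu i).le,
    fun i => isGram_of_norm_le_one (hy i), ?_⟩
  have hbb (k l) : C (1, k) (1, l) = C (0, k) (0, l) := (congrFun (congrFun hb k) l).symm
  have hH (p r) : C p r = star (C r p) := (hC.1.apply p r).symm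
  have h' : C (0, 1) (1, 1) = C (0, 0) (1, 0) := h.symm
  ext ⟨i, k⟩ ⟨j, l⟩
  simp only [Matrix.sum_apply, Matrix.smul_apply, kroneckerMap_apply, smul_eq_mul]
  fin_cases i <;> fin_cases j <;> fin_cases k <;> fin_cases l
  all_goals simp only [Fin.zero_eta, Fin.mk_one, Matrix.of_apply, Matrix.cons_val',
    Matrix.cons_val_zero, Matrix.cons_val_one, Matrix.cons_val_fin_one, mul_one, one_mul]
  -- entries below the diagonal are reduced to those above it by hermiticity
  all_goals first
    | rw [hd, hq1]
    | rw [hbb, hd, hq1]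
    | rw [hbb, hA']
    | rw [hA']
    | rw [h', hqu]
    | rw [hqu]
    | rw [hB1]
    | rw [hB2]
    | (rw [hH, ← hA', star_sum]; simp)
    | (rw [hbb, hH, ← hA', star_sum]; simp)
    | (rw [hH, ← hqu, star_sum]; simp [mul_comm])
    | (rw [hH, h', ← hqu, star_sum]; simp [mul_comm])
    | (rw [hH, ← hB1, star_sum]; simp)
    | (rw [hH, ← hB2, star_sum]; simp)

/-! ### Passive memories and mixtures -/

/-- For `E : X ↦ tr X · (all-ones)` the output of the circuit depends on the input only through the
state of the memory, while `⟨0|Ξ[E](|k⟩⟨k|)|1⟩` is the `k`-th diagonal entry of `C₀₁`. -/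
theorem block_diag_eq_of_passive {Ξ : Supermap (Fin 2)}
    {C : Matrix (Fin 2 × Fin 2) (Fin 2 × Fin 2) ℂ} (hC : IsAssociatedMatrix Ξ C)
    {N : Circuit (Fin 2)} (hN : N.Realizes Ξ) (hp : N.IsPassive) :
    block C 0 1 0 0 = block C 0 1 1 1 := by
  let E : OpMap (Fin 2) (Fin 2) :=
    { toFun X := Matrix.of fun _ _ => X.trace
      map_add' := by intros; ext; simp
      map_smul' := by intros; ext; simp }
  have key (ρ : Matrix (Fin 2) (Fin 2) ℂ) : tensorId E (Fin N.dMem) (N.enc (ρ ⊗ₖ N.τ)) =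
      (N.memory ρ).submatrix Prod.snd Prod.snd := by
    ext p q
    simp [tensorId, E, Circuit.memory, traceFst, Matrix.trace]
  have hs (k : Fin 2) : IsState (Matrix.single k k (1 : ℂ)) := by
    refine ⟨?_, by simp⟩
    rw [← Matrix.diagonal_single]
    exact PosSemidef.diagonal (by simp)
  have h (k : Fin 2) : C (0, k) (1, k) = Ξ E (Matrix.single k k 1) 0 1 := by
    rw [hC.apply_single]
    simp [E]
  simp only [block, Matrix.of_apply]
  rw [h, h, hN, hN, Circuit.output, Circuit.output, key, key, hp _ _ (hs 0) (hs 1)]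

/-- The direct sum of a family of matrices, the second index being the label of the summand. -/
def directSum {S : Type} {n : ℕ} (G : Fin n → Matrix S S ℂ) :
    Matrix (S × Fin n) (S × Fin n) ℂ :=
  Matrix.of fun p q => if p.2 = q.2 then G p.2 p.1 q.1 else 0

theorem isGram_directSum {S : Type} [Fintype S] {n : ℕ} {G : Fin n → Matrix S S ℂ}
    (hG : ∀ i, IsGram (G i)) : IsGram (directSum G) := by
  refine ⟨?_, fun p => by simp [directSum, (hG _).2]⟩
  have h : directSum G = ∑ i, G i ⊗ₖ Matrix.single i i (1 : ℂ) := by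
    ext p q
    by_cases hpq : p.2 = q.2
    · simp [directSum, Matrix.sum_apply, Matrix.single_apply, hpq]
    · simp [directSum, Matrix.sum_apply, Matrix.single_apply, hpq]
      refine (Finset.sum_eq_zero fun i _ => ?_).symm
      aesop
  rw [h]
  refine posSemidef_sum _ fun i _ => (hG i).1.kronecker ?_
  rw [← Matrix.diagonal_single]
  exact PosSemidef.diagonal (by simp)

/-- For `C = ∑ q_γ C₁⁽γ⁾ ⊗ C₂⁽γ⁾` the memory is a classical label `γ` drawn with probability `q_γ`;
the encoder multiplies the qubit entrywise by `C₂⁽γ⁾` and the decoder by `C₁⁽γ⁾`. -/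
theorem exists_passive_circuit {Ξ : Supermap (Fin 2)}
    {C : Matrix (Fin 2 × Fin 2) (Fin 2 × Fin 2) ℂ} (hC : IsAssociatedMatrix Ξ C)
    (h : IsClassicalMixture C) : ∃ N : Circuit (Fin 2), N.Realizes Ξ ∧ N.IsPassive := by
  obtain ⟨n, q, C₁, C₂, hq, hq1, h₁, h₂, hsum⟩ := h
  let N : Circuit (Fin 2) :=
    { dInit := n
      dMem := n
      dFin := n
      τ := Matrix.diagonal fun i => (q i : ℂ)
      isState := ⟨PosSemidef.diagonal fun i => by simpa using hq i, by
        rw [Matrix.trace_diagonal]; exact_mod_cast hq1⟩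
      enc := hadamardMap (directSum C₂)
      enc_isChannel := isChannel_hadamardMap (isGram_directSum h₂)
      dec := hadamardMap (directSum C₁)
      dec_isChannel := isChannel_hadamardMap (isGram_directSum h₁) }
  have henc (ρ : Matrix (Fin 2) (Fin 2) ℂ) (γ : Fin n) :
      (Matrix.of fun a a' => N.enc (ρ ⊗ₖ N.τ) (a, γ) (a', γ)) =
        (q γ : ℂ) • hadamard (C₂ γ) ρ := by
    ext a b
    simp [N, hadamardMap, directSum]
    ring
  refine ⟨N, fun E ρ => ?_, fun ρ ρ' hρ hρ' => ?_⟩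
  · have hout : N.output E ρ = ∑ γ, (q γ : ℂ) • hadamard (C₁ γ) (E (hadamard (C₂ γ) ρ)) := by
      ext i j
      simp only [Circuit.output, traceSnd, Matrix.of_apply, Matrix.sum_apply]
      refine Finset.sum_congr rfl fun γ _ => ?_
      change directSum C₁ (i, γ) (j, γ) * tensorId E (Fin n) _ (i, γ) (j, γ) = _
      simp only [tensorId, Matrix.of_apply]
      erw [henc]
      simp [directSum]
      ring
    rw [hout]
    -- both sides are linear in `ρ`, so it suffices to compare them on matrix units
    let Φ : OpMap (Fin 2) (Fin 2) :=
      ∑ γ, (q γ : ℂ) • (hadamardMap (C₁ γ) ∘ₗ E ∘ₗ hadamardMap (C₂ γ))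
    have hΦ : Ξ E = Φ := by
      refine Matrix.ext_linearMap _ fun k l => LinearMap.ext fun z => ?_
      have hz : Matrix.single k l z = z • Matrix.single k l (1 : ℂ) := by simp
      simp only [LinearMap.comp_apply, Matrix.singleLinearMap_apply]
      rw [hz, map_smul, map_smul]
      congr 1
      ext i j
      have hs (γ) : hadamard (C₂ γ) (Matrix.single k l 1) =
          C₂ γ k l • Matrix.single k l (1 : ℂ) := by
        ext a b
        simp [Matrix.single_apply]
        aesop
      rw [hC.apply_single, hsum]
      simp only [Φ, hadamardMap, LinearMap.sum_apply, LinearMap.smul_apply, LinearMap.comp_apply,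
        LinearMap.coe_mk, AddHom.coe_mk, hs, map_smul, Matrix.sum_apply, Matrix.smul_apply,
        hadamard_apply, kroneckerMap_apply, smul_eq_mul, Finset.mul_sum]
      exact Finset.sum_congr rfl fun γ _ => by ring
    rw [hΦ]
    simp [Φ, hadamardMap]
  · have hmem (σ : Matrix (Fin 2) (Fin 2) ℂ) (hσ : IsState σ) : N.memory σ = N.τ := by
      have ht := hσ.2
      ext γ η
      simp only [Circuit.memory, traceFst, Matrix.of_apply]
      by_cases hγ : γ = η
      · subst hγ
        rw [Matrix.trace_fin_two] at ht
        simp [N, hadamardMap, directSum, (h₂ _).2, ← Finset.sum_mul]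
        linear_combination (q γ : ℂ) * ht
      · simp [N, hadamardMap, directSum, hγ]
    rw [hmem ρ hρ, hmem ρ' hρ']

end Dephasing

theorem proposition1 (Ξ : Dephasing.Supermap (Fin 2))
    (C : Matrix (Fin 2 × Fin 2) (Fin 2 × Fin 2) ℂ)
    (hΞ : Dephasing.IsDephasingSuperchannel Ξ) (hC : Dephasing.IsAssociatedMatrix Ξ C) :
    List.TFAE [
      ∃ N : Dephasing.Circuit (Fin 2), N.Realizes Ξ ∧ N.IsPassive,
      Dephasing.IsClassicalMixture C,
      Dephasing.block C 0 1 0 0 = Dephasing.block C 0 1 1 1] := by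
  tfae_have 1 → 3 := fun ⟨_, hN, hp⟩ => Dephasing.block_diag_eq_of_passive hC hN hp
  tfae_have 3 → 2 := fun h => Dephasing.isClassicalMixture_of_blocks
    (Dephasing.IsAssociatedMatrix.posSemidef hΞ.1 hC)
    (Dephasing.IsAssociatedMatrix.apply_diag hΞ.1 hC)
    (Dephasing.IsAssociatedMatrix.block_zero_eq_block_one hΞ.1 hC) h
  tfae_have 2 → 1 := Dephasing.exists_passive_circuit hC
  tfae_finish
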